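/- Let $\mathcal W$ be the Wiener algebra of series $a(z)=\sum_{i\in\mathbb Z}a_iz^i$ with $\sum_i|a_i|<\infty$, let $T(a)=(a_{j-i})_{i,j\ge1}$ be the semi-infinite Toeplitz matrix with symbol $a$, let $\mathcal K_d$ be the set of matrices $E=(e_{i,j})_{i,j\ge1}$ with finite absolute row sums and $\lim_{i}\sum_j|e_{i,j}|=0$, and let $\mathcal{QT}_\infty=\{T(a)+E:\ a\in\mathcal W,\ E\in\mathcal K_d\}$, regarded as bounded operators on $\ell^\infty$ with the norm $\|A\|_\infty=\sup_i\sum_j|a_{i,j}|$. Write $\rho$ for the spectral radius. A matrix $A\in\mathcal{QT}_\infty$ is a (quasi-Toeplitz) $M$-matrix if $A=\beta I-C$ with $\beta\ge0$, $C\ge0$ entrywise and $\rho(C)\le\beta$. **Theorem.** Let $A=I-A_1\in\mathcal{QT}_\infty$ with $A_1\ge0$ entrywise and $\|A_1\|_\infty<1$, and let $B=T(b)+E_B$ with $b\in\mathcal W$, $E_B\in\mathcal K_d$ be such that $I-B$ is the quasi-Toeplitz $M$-matrix with $(I-B)^2=A$. Then $2I-T(b)$, $2I-B$ and, with $V=(2I-B)^{-1}$,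 also $I-T(b)V$ are invertible, and we put $$S=(2I-T(b))^{-1},\qquad R=T(b)^2-2T(b)+A_1,\qquad Z=(I-T(b)V)\,V\,(I-T(b)V)^{-1}.$$ Apply the structure-preserving doubling algorithm (SDA) to the pencil $\mathcal M-\lambda\mathcal N$, $$\mathcal M=\begin{bmatrix}SA_1&0\\-SR&I\end{bmatrix},\qquad \mathcal N=\begin{bmatrix}I&-S\\0&S\end{bmatrix},$$ that is, put $E_0=SA_1$, $P_0=SR$, $F_0=Q_0=S$ and $$\begin{aligned}E_{k+1}&=E_k(I-Q_kP_k)^{-1}E_k,& P_{k+1}&=P_k+F_k(I-P_kQ_k)^{-1}P_kE_k,\\ F_{k+1}&=F_k(I-P_kQ_k)^{-1}F_k,& Q_{k+1}&=Q_k+E_k(I-Q_kP_k)^{-1}Q_kF_k.\end{aligned}$$ Suppose that there is no breakdown, that is, $I-Q_kP_k$ and $I-P_kQ_k$ are invertible for all $k\ge0$. Then $P_k\to E_B$ in norm, and the convergence is quadratic in the sense that $$\limsup_{k\to\infty}\|E_B-P_k\|_\infty^{1/2^k}\le\rho(B)\,\rho(Z)<1 .$$ -/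

import Mathlib

open Filter Topology
open scoped ENNReal

/-- The complex Banach space `ℓ^∞` of bounded sequences, indexed by `ℕ` (rows and columns of
semi-infinite matrices are numbered from `0`). -/
abbrev LInf : Type := lp (fun _ : ℕ => ℂ) ∞

/-- `𝓑(ℓ^∞)`, the Banach algebra of bounded operators on `ℓ^∞` with the operator norm. For an
operator given by a matrix this norm is the infinity norm `sup_i ∑_j |m i j|`. -/
abbrev LInfOp : Type := LInf →L[ℂ] LInf

/-- The absolute row sums of the semi-infinite matrix `m` are finite and uniformly bounded, that
is, `‖m‖_∞ < ∞`. -/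
def BoundedRows (m : ℕ → ℕ → ℂ) : Prop :=
  ∃ C : ℝ, ∀ i, Summable (fun j => ‖m i j‖) ∧ ∑' j, ‖m i j‖ ≤ C

theorem BoundedRows.row_bound {m : ℕ → ℕ → ℂ} {C : ℝ}
    (hC : ∀ i, Summable (fun j => ‖m i j‖) ∧ ∑' j, ‖m i j‖ ≤ C) (x : LInf) (i : ℕ) :
    Summable (fun j => ‖m i j * x j‖) ∧ ‖∑' j, m i j * x j‖ ≤ C * ‖x‖ := by
  have hle : ∀ j, ‖m i j * x j‖ ≤ ‖m i j‖ * ‖x‖ := fun j => by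
    rw [norm_mul]
    exact mul_le_mul_of_nonneg_left (lp.norm_apply_le_norm ENNReal.top_ne_zero x j)
      (norm_nonneg _)
  have hs' : Summable (fun j => ‖m i j‖ * ‖x‖) := (hC i).1.mul_right _
  have hs : Summable (fun j => ‖m i j * x j‖) :=
    Summable.of_nonneg_of_le (fun _ => norm_nonneg _) hle hs'
  refine ⟨hs, (norm_tsum_le_tsum_norm hs).trans ((hs.tsum_le_tsum hle hs').trans ?_)⟩
  rw [tsum_mul_right]
  exact mul_le_mul_of_nonneg_right (hC i).2 (norm_nonneg _)

theorem BoundedRows.memℓp {m : ℕ → ℕ → ℂ} (hm : BoundedRows m) (x : LInf) :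
    Memℓp (fun i => ∑' j, m i j * x j) ∞ := by
  obtain ⟨C, hC⟩ := hm
  refine memℓp_infty ⟨C * ‖x‖, ?_⟩
  rintro _ ⟨i, rfl⟩
  exact (BoundedRows.row_bound hC x i).2

/-- The bounded operator `x ↦ (∑_j m i j * x j)_i` on `ℓ^∞` of a matrix with bounded rows. -/
noncomputable def matrixOp (m : ℕ → ℕ → ℂ) (hm : BoundedRows m) : LInfOp :=
  LinearMap.mkContinuousOfExistsBound
    { toFun := fun x => ⟨fun i => ∑' j, m i j * x j, hm.memℓp x⟩
      map_add' := by
        intro x y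
        obtain ⟨C, hC⟩ := hm
        ext i
        have hx := (BoundedRows.row_bound hC x i).1.of_norm
        have hy := (BoundedRows.row_bound hC y i).1.of_norm
        change ∑' j, m i j * (x j + y j) = ∑' j, m i j * x j + ∑' j, m i j * y j
        rw [← hx.tsum_add hy]
        simp only [mul_add]
      map_smul' := by
        intro c x
        ext i
        change ∑' j, m i j * (c * x j) = c * ∑' j, m i j * x j
        rw [← tsum_mul_left]
        simp only [mul_left_comm] }
    (by
      obtain ⟨C, hC⟩ := hm
      refine ⟨C, fun x => ?_⟩
      have h0 : 0 ≤ C := (tsum_nonneg fun j => norm_nonneg (m 0 j)).trans (hC 0).2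
      exact lp.norm_le_of_forall_le (mul_nonneg h0 (norm_nonneg x))
        fun i => (BoundedRows.row_bound hC x i).2)

/-- The Wiener algebra `𝓦`: absolutely summable two-sided coefficient sequences, `a` standing for
the function `∑_{i ∈ ℤ} a i * z ^ i` on the unit circle. -/
abbrev Wiener : Type := {a : ℤ → ℂ // Summable fun n => ‖a n‖}

theorem Wiener.boundedRows (a : Wiener) :
    BoundedRows (fun i j => a.1 ((j : ℤ) - (i : ℤ))) := by
  refine ⟨∑' n, ‖a.1 n‖, fun i => ?_⟩
  have hinj : Function.Injective (fun j : ℕ => (j : ℤ) - (i : ℤ)) := fun j k h => by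
    have h' : (j : ℤ) - (i : ℤ) = (k : ℤ) - (i : ℤ) := h
    omega
  exact ⟨a.2.comp_injective hinj, tsum_comp_le_tsum_of_inj a.2 (fun _ => norm_nonneg _) hinj⟩

/-- The semi-infinite Toeplitz matrix `T(a)`, with entries `(T(a))_{i,j} = a_{j-i}`. -/
noncomputable def toeplitz (a : Wiener) : LInfOp :=
  matrixOp (fun i j => a.1 ((j : ℤ) - (i : ℤ))) a.boundedRows

/-- `𝓚_d(ℓ^∞)`: (operators of) matrices `e` whose absolute row sums are finite and tend to `0`. -/
def Kd : Set LInfOp :=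
  {E | ∃ (e : ℕ → ℕ → ℂ) (he : BoundedRows e),
    Tendsto (fun i => ∑' j, ‖e i j‖) atTop (𝓝 0) ∧ E = matrixOp e he}

/-- The class `𝓠𝓣_∞` of quasi-Toeplitz matrices `T(a) + E`, `a ∈ 𝓦`, `E ∈ 𝓚_d(ℓ^∞)`. -/
def QT : Set LInfOp :=
  {A | ∃ (a : Wiener) (E : LInfOp), E ∈ Kd ∧ A = toeplitz a + E}

/-- The entry in position `(i, j)` of the matrix of an operator. -/
noncomputable def entry (A : LInfOp) (i j : ℕ) : ℂ :=
  (A (lp.single ∞ j (1 : ℂ)) : LInf) i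

/-- Elementwise nonnegativity `A ≥ 0`: every entry is a nonnegative real number. -/
def EntrywiseNonneg (A : LInfOp) : Prop :=
  ∀ i j, 0 ≤ (entry A i j).re ∧ (entry A i j).im = 0

/-- Quasi-Toeplitz `M`-matrices: `A ∈ 𝓠𝓣_∞` with `A = β I - C`, `C ≥ 0` and `β ≥ ρ(C)`. -/
def IsQTMMatrix (A : LInfOp) : Prop :=
  A ∈ QT ∧ ∃ (β : ℝ) (C : LInfOp), 0 ≤ β ∧ EntrywiseNonneg C ∧
    spectralRadius ℂ C ≤ ENNReal.ofReal β ∧ A = (β : ℂ) • (1 : LInfOp) - C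

/-- Coefficients of a pencil `M - λ N` in standard structured form I,
`M = [E, 0; -P, I]`, `N = [I, -Q; 0, F]`. -/
@[ext]
structure SSF (R : Type*) where
  E : R
  P : R
  F : R
  Q : R

/-- The matrix `M = [E, 0; -P, I]` of the pencil. -/
def SSF.M {R : Type*} [Ring R] (s : SSF R) : Matrix (Fin 2) (Fin 2) R :=
  !![s.E, 0; -s.P, 1]

/-- The matrix `N = [I, -Q; 0, F]` of the pencil. -/
def SSF.N {R : Type*} [Ring R] (s : SSF R) : Matrix (Fin 2) (Fin 2) R :=
  !![1, -s.Q; 0, s.F]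

/-- One doubling step. `Ring.inverse` is the two-sided inverse wherever there is one. -/
noncomputable def SSF.step {R : Type*} [Ring R] (s : SSF R) : SSF R where
  E := s.E * Ring.inverse (1 - s.Q * s.P) * s.E
  P := s.P + s.F * Ring.inverse (1 - s.P * s.Q) * s.P * s.E
  F := s.F * Ring.inverse (1 - s.P * s.Q) * s.F
  Q := s.Q + s.E * Ring.inverse (1 - s.Q * s.P) * s.Q * s.F

/-- The `k`-th iterate `(E_k, P_k, F_k, Q_k)` of the structure-preserving doubling algorithm. -/
noncomputable def SSF.sda {R : Type*} [Ring R] (s : SSF R) : ℕ → SSF R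
  | 0 => s
  | k + 1 => (s.sda k).step

/-- The doubling algorithm runs with no breakdown: every inverse that it uses exists. -/
def SSF.NoBreakdown {R : Type*} [Ring R] (s : SSF R) : Prop :=
  ∀ k, IsUnit (1 - (s.sda k).Q * (s.sda k).P) ∧ IsUnit (1 - (s.sda k).P * (s.sda k).Q)

/-! Write `X = E_B` and `Y = V (I - T(b) V)⁻¹`. The columns `[I; X]` and `[Y; I]` span two deflating
subspaces of the pencil: `M [I; X] = N [I; X] B` and `N [Y; I] = M [Y; I] Z`. A doubling step keeps
both subspaces and squares `B` and `Z`, so that after `k` steps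
`X - P_k = (I - P_k Y) Z^(2^k) X B^(2^k)`. Replacing `P_k` by `X - (X - P_k)` on the right bounds
`‖X - P_k‖` by a constant times `‖Z^(2^k)‖ ‖B^(2^k)‖`, and Gelfand's formula gives the rate.

That the rate is less than one comes from `‖B‖ < 1`. The iteration `y ↦ (A₁ + y²) / 2` contracts a
ball of radius less than one, and its fixed point `D` satisfies `(I - D)² = I - A₁` and commutes
with `B`. As `I - B` is an `M`-matrix, `(I - B) + (I - D)` is invertible, which forces `B = D`.
Finally `‖T(b)‖ ≤ ‖T(b) + E_B‖ = ‖B‖`, since shifting a vector far enough makes `E_B` negligible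
without affecting `T(b)`. -/

/-! ### Deflating subspaces under doubling -/

namespace SSF

section Ring

variable {R : Type*} [Ring R] {s : SSF R} {X W Y Z : R}

/-- The pencil with the roles of `(E, P)` and `(F, Q)` exchanged. Up to a permutation of the block
rows and columns this exchanges `M` and `N`. -/
def swap (s : SSF R) : SSF R := ⟨s.F, s.Q, s.E, s.P⟩

theorem swap_sda (s : SSF R) (k : ℕ) : s.swap.sda k = (s.sda k).swap := by
  induction k with
  | zero => rfl
  | succ k ih => rw [sda, ih]; rfl

theorem NoBreakdown.swap (hs : s.NoBreakdown) : s.swap.NoBreakdown := fun k => by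
  rw [swap_sda]
  exact (hs k).symm

/-- `[1; X]` spans a deflating subspace of the pencil, on which the pencil acts as `W`:
this is the equation `M [1; X] = N [1; X] W`, written out in blocks. For `s.swap` it reads
`N [X; 1] = M [X; 1] W`. -/
def IsDeflatingPair (s : SSF R) (X W : R) : Prop :=
  s.E = (1 - s.Q * X) * W ∧ X - s.P = s.F * X * W

theorem IsDeflatingPair.step (h : s.IsDeflatingPair X W)
    (hQP : IsUnit (1 - s.Q * s.P)) (hPQ : IsUnit (1 - s.P * s.Q)) :
    s.step.IsDeflatingPair X (W ^ 2) := by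
  obtain ⟨E, P, F, Q⟩ := s
  obtain ⟨hE : E = (1 - Q * X) * W, hX : X - P = F * X * W⟩ := h
  have hG := Ring.inverse_mul_cancel _ hQP
  have hH := Ring.inverse_mul_cancel _ hPQ
  dsimp only at hG hH
  simp only [SSF.step, IsDeflatingPair]
  set G := Ring.inverse (1 - Q * P)
  set H := Ring.inverse (1 - P * Q)
  have hGE : G * E = W - G * Q * F * X * W * W :=
    calc G * E = G * ((1 - Q * P) * W - Q * (X - P) * W) := by rw [hE]; noncomm_ring
      _ = (G * (1 - Q * P)) * W - G * (Q * (X - P) * W) := by noncomm_ring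
      _ = W - G * Q * F * X * W * W := by rw [hG, hX]; noncomm_ring
  have hHPE : X * W - H * P * E = H * F * X * W * W :=
    calc X * W - H * P * E = (H * (1 - P * Q)) * X * W - H * P * ((1 - Q * X) * W) := by
          rw [hH, ← hE]; noncomm_ring
      _ = H * (X - P) * W := by noncomm_ring
      _ = H * F * X * W * W := by rw [hX]; noncomm_ring
  constructor
  · calc E * G * E = E * W - E * G * Q * F * X * W * W := by rw [mul_assoc, hGE]; noncomm_ring
      _ = (1 - (Q + E * G * Q * F) * X) * W ^ 2 := by nth_rw 1 [hE]; noncomm_ring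
  · calc X - (P + F * H * P * E) = (X - P) - F * H * P * E := by noncomm_ring
      _ = F * (X * W - H * P * E) := by rw [hX]; noncomm_ring
      _ = F * H * F * X * W ^ 2 := by rw [hHPE]; noncomm_ring

theorem IsDeflatingPair.sda (h : s.IsDeflatingPair X W) (hs : s.NoBreakdown) (k : ℕ) :
    (s.sda k).IsDeflatingPair X (W ^ 2 ^ k) := by
  induction k with
  | zero => simpa only [SSF.sda, pow_zero, pow_one] using h
  | succ k ih =>
    rw [pow_succ, pow_mul]
    exact ih.step (hs k).1 (hs k).2

theorem IsDeflatingPair.sub_sda_P_eq (h : s.IsDeflatingPair X W) (h' : s.swap.IsDeflatingPair Y Z)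
    (hs : s.NoBreakdown) (k : ℕ) :
    X - (s.sda k).P = (1 - X * Y) * Z ^ 2 ^ k * X * W ^ 2 ^ k
      + (X - (s.sda k).P) * (Y * Z ^ 2 ^ k * X * W ^ 2 ^ k) := by
  have hX : X - (s.sda k).P = (s.sda k).F * X * W ^ 2 ^ k := (h.sda hs k).2
  have hF : (s.sda k).F = (1 - (s.sda k).P * Y) * Z ^ 2 ^ k := by
    have hE := (h'.sda hs.swap k).1
    rwa [swap_sda] at hE
  conv_lhs => rw [hX, hF]
  noncomm_ring

end Ring

end SSF

section SqrtPencil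

variable {R : Type*} [Ring R] {A₁ B T X S V J : R}

/-- The initial data of the doubling algorithm for a square root `1 - (T + X)` of `1 - A₁` with
unknown `X`. Here `S` stands for `(2 - T)⁻¹`. -/
def sqrtPencil (A₁ T S : R) : SSF R where
  E := S * A₁
  P := S * (T ^ 2 - 2 * T + A₁)
  F := S
  Q := S

theorem SSF.eq_sqrtPencil {s : SSF R}
    (hM : s.M = !![S * A₁, 0; -(S * (T ^ 2 - 2 * T + A₁)), 1]) (hN : s.N = !![1, -S; 0, S]) :
    s = sqrtPencil A₁ T S := by
  ext1
  · exact congrFun₂ hM 0 0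
  · exact neg_injective (congrFun₂ hM 1 0)
  · exact congrFun₂ hN 1 1
  · exact neg_injective (congrFun₂ hN 0 1)

theorem eq_mul_of_sq_one_sub_eq (hsq : (1 - B) ^ 2 = 1 - A₁) : A₁ = (2 - B) * B :=
  calc A₁ = 1 - (1 - B) ^ 2 := by rw [hsq, sub_sub_cancel]
    _ = (2 - B) * B := by noncomm_ring

theorem sqrtPencil_isDeflatingPair (hB : B = T + X) (hsq : (1 - B) ^ 2 = 1 - A₁)
    (hS : S * (2 - T) = 1) : (sqrtPencil A₁ T S).IsDeflatingPair X B := by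
  have hA₁ : A₁ = (2 - B) * B := eq_mul_of_sq_one_sub_eq hsq
  constructor
  · calc S * A₁ = (S * (2 - T) - S * X) * B := by rw [hA₁, hB]; noncomm_ring
      _ = (1 - S * X) * B := by rw [hS]
  · calc X - S * (T ^ 2 - 2 * T + A₁)
        = (S * (2 - T)) * X - S * (T ^ 2 - 2 * T + A₁) := by rw [hS, one_mul]
      _ = S * X * B := by rw [hA₁, hB]; noncomm_ring

theorem sqrtPencil_swap_isDeflatingPair (hsq : (1 - B) ^ 2 = 1 - A₁) (hS : S * (2 - T) = 1)
    (hV : (2 - B) * V = 1) (hJ : (1 - T * V) * J = 1) (hJ' : J * (1 - T * V) = 1) :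
    (sqrtPencil A₁ T S).swap.IsDeflatingPair (V * J) ((1 - T * V) * V * J) := by
  set Y := V * J with hY
  set Z := (1 - T * V) * V * J with hZ
  have hYZ : Y * Z = V * V * J :=
    calc Y * Z = V * (J * (1 - T * V)) * V * J := by rw [hY, hZ]; noncomm_ring
      _ = V * V * J := by rw [hJ', mul_one]
  have hA₁V : A₁ * V * V = 2 * V - 1 :=
    calc A₁ * V * V = B * ((2 - B) * V) * V := by
          rw [eq_mul_of_sq_one_sub_eq hsq]; noncomm_ring
      _ = B * V := by rw [hV, mul_one]
      _ = 2 * V - (2 - B) * V := by noncomm_ring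
      _ = 2 * V - 1 := by rw [hV]
  have hA₁YZ : A₁ * (Y * Z) = (2 - T) * Y - 1 :=
    calc A₁ * (Y * Z) = A₁ * V * V * J := by rw [hYZ]; noncomm_ring
      _ = (2 - T) * Y - (1 - T * V) * J := by rw [hA₁V, hY]; noncomm_ring
      _ = (2 - T) * Y - 1 := by rw [hJ]
  have hRYZ : (T ^ 2 - 2 * T + A₁) * (Y * Z) = (2 - T) * Z - 1 :=
    calc (T ^ 2 - 2 * T + A₁) * (Y * Z)
        = (T ^ 2 - 2 * T) * (V * V * J) + A₁ * (Y * Z) := by rw [add_mul, hYZ]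
      _ = (2 - T) * Z - 1 := by rw [hA₁YZ, hZ, hY]; noncomm_ring
  constructor
  · calc S = (S * (2 - T)) * Z - S * ((2 - T) * Z - 1) := by noncomm_ring
      _ = (1 - S * (T ^ 2 - 2 * T + A₁) * Y) * Z := by rw [hS, ← hRYZ]; noncomm_ring
  · calc Y - S = (S * (2 - T)) * Y - S := by rw [hS, one_mul]
      _ = S * ((2 - T) * Y - 1) := by noncomm_ring
      _ = S * A₁ * Y * Z := by rw [← hA₁YZ]; noncomm_ring

end SqrtPencil

/-! ### Spectral radii -/

theorem tendsto_ennreal_const_rpow_one {ι : Type*} {l : Filter ι} {e : ι → ℝ}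
    (he : Tendsto e l (𝓝 0)) {c : ℝ≥0∞} (hc₀ : c ≠ 0) (hc : c ≠ ∞) :
    Tendsto (fun i => c ^ e i) l (𝓝 1) := by
  lift c to NNReal using hc
  have hc₀' : c ≠ 0 := ENNReal.coe_ne_zero.1 hc₀
  have h : Tendsto (fun i => c ^ e i) l (𝓝 (c ^ (0 : ℝ))) :=
    tendsto_const_nhds.nnrpow he (Or.inl hc₀')
  rw [NNReal.rpow_zero, ← ENNReal.tendsto_coe] at h
  exact h.congr fun i => ENNReal.coe_rpow_of_ne_zero hc₀' _

theorem tendsto_zero_of_tendsto_rpow_lt_one {ι : Type*} {l : Filter ι} {e : ι → ℝ}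
    (he : Tendsto e l (𝓝[>] 0)) {x : ι → ℝ≥0∞} {ρ : ℝ≥0∞} (hρ : ρ < 1)
    (hx : Tendsto (fun i => x i ^ e i) l (𝓝 ρ)) : Tendsto x l (𝓝 0) := by
  obtain ⟨r, hρr, hr⟩ := exists_between hρ
  have hpow : Tendsto (fun i => r ^ (e i)⁻¹) l (𝓝 0) :=
    (ENNReal.tendsto_rpow_atTop_of_base_lt_one hr).comp (tendsto_inv_nhdsGT_zero.comp he)
  refine tendsto_of_tendsto_of_tendsto_of_le_of_le' tendsto_const_nhds hpow
    (Eventually.of_forall fun _ => zero_le) ?_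
  filter_upwards [hx.eventually_lt_const hρr, he.eventually self_mem_nhdsWithin] with i hi hei
  calc x i = (x i ^ e i) ^ (e i)⁻¹ := (ENNReal.rpow_rpow_inv (ne_of_gt hei) _).symm
    _ ≤ r ^ (e i)⁻¹ := ENNReal.rpow_le_rpow hi.le (inv_nonneg.2 (le_of_lt hei))

theorem tendsto_one_div_two_pow_nhdsGT_zero :
    Tendsto (fun k : ℕ => (1 : ℝ) / 2 ^ k) atTop (𝓝[>] 0) := by
  simp only [one_div]
  exact tendsto_inv_atTop_nhdsGT_zero.comp (tendsto_pow_atTop_atTop_of_one_lt one_lt_two)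

theorem norm_add_pow_le_of_commute {R : Type*} [NormedRing R] {a b : R} (hab : Commute a b)
    {M N r s : ℝ} (ha : ∀ n, ‖a ^ n‖ ≤ M * r ^ n) (hb : ∀ n, ‖b ^ n‖ ≤ N * s ^ n) (n : ℕ) :
    ‖(a + b) ^ n‖ ≤ M * N * (r + s) ^ n := by
  rw [hab.add_pow, add_pow, Finset.mul_sum]
  refine norm_sum_le_of_le _ fun m _ => ?_
  calc ‖a ^ m * b ^ (n - m) * (n.choose m)‖
      ≤ n.choose m * ‖a ^ m * b ^ (n - m)‖ := by
        rw [← nsmul_eq_mul']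
        exact norm_nsmul_le
    _ ≤ n.choose m * ((M * r ^ m) * (N * s ^ (n - m))) := by
        gcongr
        exact norm_mul_le_of_le (ha m) (hb (n - m))
    _ = M * N * (r ^ m * s ^ (n - m) * n.choose m) := by ring

theorem spectralRadius_mul_mul_ringInverse {𝕜 A : Type*} [NormedField 𝕜] [Ring A] [Algebra 𝕜 A]
    {u : A} (hu : IsUnit u) (a : A) :
    spectralRadius 𝕜 (u * a * Ring.inverse u) = spectralRadius 𝕜 a := by
  obtain ⟨u, rfl⟩ := hu
  rw [Ring.inverse_unit, spectralRadius, spectrum.units_conjugate, spectralRadius]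

section BanachAlgebra

variable {𝔸 : Type*} [NormedRing 𝔸] [NormedAlgebra ℂ 𝔸] [CompleteSpace 𝔸]

theorem spectralRadius_ne_top (a : 𝔸) : spectralRadius ℂ a ≠ ∞ := by
  have h := spectrum.spectralRadius_le_pow_nnnorm_pow_one_div ℂ a 0
  exact ne_top_of_le_ne_top (by finiteness) h

theorem exists_norm_pow_le_of_spectralRadius_lt {a : 𝔸} {r : ℝ}
    (h : spectralRadius ℂ a < ENNReal.ofReal r) : ∃ M, ∀ n, ‖a ^ n‖ ≤ M * r ^ n := by
  have hr : 0 < r := ENNReal.ofReal_pos.1 (zero_le.trans_lt h)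
  have hroot := spectrum.pow_norm_pow_one_div_tendsto_nhds_spectralRadius a
  have hO : (fun n => a ^ n) =O[atTop] fun n => r ^ n := by
    refine Asymptotics.IsBigO.of_bound' ?_
    filter_upwards [hroot.eventually_lt_const h, eventually_ne_atTop 0] with n hn hn₀
    rw [ENNReal.ofReal_lt_ofReal_iff hr] at hn
    calc ‖a ^ n‖ = (‖a ^ n‖ ^ (1 / n : ℝ)) ^ n := by
          rw [one_div, Real.rpow_inv_natCast_pow (norm_nonneg _) hn₀]
      _ ≤ r ^ n := by gcongr
      _ = ‖r ^ n‖ := (Real.norm_of_nonneg (by positivity)).symm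
  obtain ⟨M, -, hM⟩ := Asymptotics.bound_of_isBigO_nat_atTop hO
  refine ⟨M, fun n => ?_⟩
  simpa only [Real.norm_of_nonneg (pow_nonneg hr.le n)] using hM (pow_ne_zero n hr.ne')

theorem spectralRadius_le_of_norm_pow_le {a : 𝔸} {M r : ℝ} (hr : 0 ≤ r)
    (h : ∀ n, ‖a ^ n‖ ≤ M * r ^ n) : spectralRadius ℂ a ≤ ENNReal.ofReal r := by
  have hM : 0 ≤ M := by simpa using (norm_nonneg _).trans (h 0)
  have hconst : Tendsto (fun n : ℕ => ENNReal.ofReal (M + 1) ^ (1 / n : ℝ) * ENNReal.ofReal r)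
      atTop (𝓝 (1 * ENNReal.ofReal r)) :=
    ENNReal.Tendsto.mul_const (tendsto_ennreal_const_rpow_one
      tendsto_one_div_atTop_nhds_zero_nat (by simpa using by linarith) ENNReal.ofReal_ne_top)
      (Or.inl one_ne_zero)
  rw [one_mul] at hconst
  refine le_of_tendsto_of_tendsto
    (spectrum.pow_norm_pow_one_div_tendsto_nhds_spectralRadius a) hconst ?_
  filter_upwards [eventually_ne_atTop 0] with n hn
  rw [ENNReal.ofReal_rpow_of_pos (by linarith), ← ENNReal.ofReal_mul (by positivity)]
  refine ENNReal.ofReal_le_ofReal ?_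
  calc ‖a ^ n‖ ^ (1 / n : ℝ) ≤ ((M + 1) * r ^ n) ^ (1 / n : ℝ) := by
        gcongr
        exact (h n).trans (by gcongr; linarith)
    _ = (M + 1) ^ (1 / n : ℝ) * r := by
        rw [Real.mul_rpow (by positivity) (by positivity), one_div, Real.pow_rpow_inv_natCast hr hn]

theorem spectralRadius_add_le_of_commute {a b : 𝔸} (hab : Commute a b) :
    spectralRadius ℂ (a + b) ≤ spectralRadius ℂ a + spectralRadius ℂ b := by
  have hlt : ∀ (c : 𝔸) {ε : ℝ}, 0 < ε →
      spectralRadius ℂ c < ENNReal.ofReal ((spectralRadius ℂ c).toReal + ε) := fun c ε hε => by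
    rw [ENNReal.lt_ofReal_iff_toReal_lt (spectralRadius_ne_top c)]
    exact lt_add_of_pos_right _ hε
  refine ENNReal.le_of_forall_pos_le_add fun ε hε _ => ?_
  have hε₂ : 0 < (ε : ℝ) / 2 := by positivity
  obtain ⟨M, hM⟩ := exists_norm_pow_le_of_spectralRadius_lt (hlt a hε₂)
  obtain ⟨N, hN⟩ := exists_norm_pow_le_of_spectralRadius_lt (hlt b hε₂)
  refine (spectralRadius_le_of_norm_pow_le (by positivity)
    (norm_add_pow_le_of_commute hab hM hN)).trans_eq ?_
  rw [add_add_add_comm, add_halves, ENNReal.ofReal_add (by positivity) (by positivity),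
    ENNReal.ofReal_add (by positivity) (by positivity), ENNReal.ofReal_coe_nnreal,
    ENNReal.ofReal_toReal (spectralRadius_ne_top a),
    ENNReal.ofReal_toReal (spectralRadius_ne_top b)]

theorem tendsto_enorm_pow_two_pow_rpow (a : 𝔸) :
    Tendsto (fun k : ℕ => ‖a ^ 2 ^ k‖ₑ ^ ((1 : ℝ) / 2 ^ k)) atTop (𝓝 (spectralRadius ℂ a)) := by
  have h := (spectrum.pow_nnnorm_pow_one_div_tendsto_nhds_spectralRadius a).comp
    (tendsto_pow_atTop_atTop_of_one_lt one_lt_two)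
  simpa only [Function.comp_def, Nat.cast_pow, Nat.cast_ofNat, enorm_eq_nnnorm] using h

theorem tendsto_enorm_pow_two_pow_mul_rpow (a b : 𝔸) :
    Tendsto (fun k : ℕ => (‖a ^ 2 ^ k‖ₑ * ‖b ^ 2 ^ k‖ₑ) ^ ((1 : ℝ) / 2 ^ k)) atTop
      (𝓝 (spectralRadius ℂ a * spectralRadius ℂ b)) := by
  refine (ENNReal.Tendsto.mul (tendsto_enorm_pow_two_pow_rpow a)
    (Or.inr (spectralRadius_ne_top b)) (tendsto_enorm_pow_two_pow_rpow b)
    (Or.inr (spectralRadius_ne_top a))).congr fun k => ?_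
  exact (ENNReal.mul_rpow_of_nonneg _ _ (by positivity)).symm

end BanachAlgebra

/-! ### Convergence of the doubling algorithm -/

theorem limsup_enorm_rpow_le_of_isBigO {ι E F : Type*} [SeminormedAddGroup E]
    [SeminormedAddCommGroup F] {l : Filter ι} [l.NeBot] {e : ι → ℝ} (he : Tendsto e l (𝓝[>] 0))
    {f : ι → E} {g : ι → F} (hfg : f =O[l] g) {ρ : ℝ≥0∞}
    (hg : Tendsto (fun i => ‖g i‖ₑ ^ e i) l (𝓝 ρ)) :
    limsup (fun i => ‖f i‖ₑ ^ e i) l ≤ ρ := by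
  obtain ⟨c, hc₀, hc⟩ := hfg.exists_pos
  have hlim : Tendsto (fun i => ENNReal.ofReal c ^ e i * ‖g i‖ₑ ^ e i) l (𝓝 (1 * ρ)) :=
    ENNReal.Tendsto.mul (tendsto_ennreal_const_rpow_one (tendsto_nhds_of_tendsto_nhdsWithin he)
      (ENNReal.ofReal_pos.2 hc₀).ne' ENNReal.ofReal_ne_top) (Or.inl one_ne_zero) hg
      (Or.inr ENNReal.one_ne_top)
  rw [← one_mul ρ, ← hlim.limsup_eq]
  refine limsup_le_limsup ?_
  filter_upwards [hc.bound, he.eventually self_mem_nhdsWithin] with i hi hei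
  rw [← ENNReal.mul_rpow_of_nonneg _ _ (le_of_lt hei)]
  refine ENNReal.rpow_le_rpow ?_ (le_of_lt hei)
  rw [← ofReal_norm, ← ofReal_norm, ← ENNReal.ofReal_mul hc₀.le]
  exact ENNReal.ofReal_le_ofReal hi

theorem norm_le_two_mul_of_eq_add_mul {R : Type*} [NonUnitalSeminormedRing R] {d u v : R}
    (h : d = u + d * v) (hv : ‖v‖ ≤ 1 / 2) : ‖d‖ ≤ 2 * ‖u‖ := by
  have hd : ‖d‖ ≤ ‖u‖ + ‖d‖ * (1 / 2) :=
    calc ‖d‖ = ‖u + d * v‖ := by rw [← h]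
      _ ≤ ‖u‖ + ‖d‖ * ‖v‖ := norm_add_le_of_le le_rfl (norm_mul_le _ _)
      _ ≤ ‖u‖ + ‖d‖ * (1 / 2) := by gcongr
  linarith

theorem mul_mul_mul_isBigO_norm_mul_norm {R : Type*} [SeminormedRing R] (u x : R) {w z : ℕ → R} :
    (fun k => u * z k * x * w k) =O[atTop] fun k => ‖w k‖ * ‖z k‖ := by
  refine .of_bound (‖u‖ * ‖x‖) (Eventually.of_forall fun k => ?_)
  calc ‖u * z k * x * w k‖ ≤ ‖u‖ * ‖z k‖ * ‖x‖ * ‖w k‖ :=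
        norm_mul_le_of_le (norm_mul₃_le) le_rfl
    _ = ‖u‖ * ‖x‖ * ‖‖w k‖ * ‖z k‖‖ := by rw [norm_mul, norm_norm, norm_norm]; ring

namespace SSF.IsDeflatingPair

theorem sub_sda_P_isBigO {R : Type*} [NormedRing R] {s : SSF R} {X W Y Z : R}
    (h : s.IsDeflatingPair X W) (h' : s.swap.IsDeflatingPair Y Z) (hs : s.NoBreakdown)
    (hWZ : Tendsto (fun k : ℕ => ‖W ^ 2 ^ k‖ * ‖Z ^ 2 ^ k‖) atTop (𝓝 0)) :
    (fun k => X - (s.sda k).P) =O[atTop] fun k => ‖W ^ 2 ^ k‖ * ‖Z ^ 2 ^ k‖ := by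
  have hsmall : Tendsto (fun k => ‖Y * Z ^ 2 ^ k * X * W ^ 2 ^ k‖) atTop (𝓝 0) :=
    (mul_mul_mul_isBigO_norm_mul_norm Y X).norm_left.trans_tendsto hWZ
  refine Asymptotics.IsBigO.trans (.of_bound 2 ?_)
    (mul_mul_mul_isBigO_norm_mul_norm (1 - X * Y) X)
  filter_upwards [hsmall.eventually_le_const one_half_pos] with k hk
  exact norm_le_two_mul_of_eq_add_mul (h.sub_sda_P_eq h' hs k) hk

variable {𝔸 : Type*} [NormedRing 𝔸] [NormedAlgebra ℂ 𝔸] [CompleteSpace 𝔸]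
  {s : SSF 𝔸} {X W Y Z : 𝔸}

theorem sda_P_tendsto_and_limsup_le (h : s.IsDeflatingPair X W) (h' : s.swap.IsDeflatingPair Y Z)
    (hs : s.NoBreakdown) (hρ : spectralRadius ℂ W * spectralRadius ℂ Z < 1) :
    Tendsto (fun k => (s.sda k).P) atTop (𝓝 X) ∧
    limsup (fun k : ℕ => ‖X - (s.sda k).P‖ₑ ^ ((1 : ℝ) / 2 ^ k)) atTop
      ≤ spectralRadius ℂ W * spectralRadius ℂ Z := by
  have hroot : Tendsto (fun k : ℕ => ‖‖W ^ 2 ^ k‖ * ‖Z ^ 2 ^ k‖‖ₑ ^ ((1 : ℝ) / 2 ^ k)) atTop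
      (𝓝 (spectralRadius ℂ W * spectralRadius ℂ Z)) := by
    simpa only [enorm_mul, enorm_norm] using tendsto_enorm_pow_two_pow_mul_rpow W Z
  have hWZ : Tendsto (fun k : ℕ => ‖W ^ 2 ^ k‖ * ‖Z ^ 2 ^ k‖) atTop (𝓝 0) :=
    tendsto_zero_iff_enorm_tendsto_zero.2
      (tendsto_zero_of_tendsto_rpow_lt_one tendsto_one_div_two_pow_nhdsGT_zero hρ hroot)
  have hO := h.sub_sda_P_isBigO h' hs hWZ
  refine ⟨?_, limsup_enorm_rpow_le_of_isBigO tendsto_one_div_two_pow_nhdsGT_zero hO hroot⟩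
  simpa only [sub_sub_cancel, sub_zero] using (hO.trans_tendsto hWZ).const_sub X

end SSF.IsDeflatingPair

/-! ### Square roots of `1 - a` -/

theorem norm_mul_self_sub_mul_self_le {R : Type*} [NonUnitalSeminormedRing R] {y z : R} {r : ℝ}
    (hy : ‖y‖ ≤ r) (hz : ‖z‖ ≤ r) : ‖y * y - z * z‖ ≤ 2 * r * ‖y - z‖ :=
  calc ‖y * y - z * z‖ = ‖y * (y - z) + (y - z) * z‖ := by congr 1; noncomm_ring
    _ ≤ ‖y‖ * ‖y - z‖ + ‖y - z‖ * ‖z‖ := norm_add_le_of_le (norm_mul_le _ _) (norm_mul_le _ _)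
    _ ≤ r * ‖y - z‖ + ‖y - z‖ * r := by gcongr
    _ = 2 * r * ‖y - z‖ := by ring

theorem exists_norm_lt_one_half_smul_add_mul_self_eq {R : Type*} [NormedRing R] [NormedAlgebra ℝ R]
    [CompleteSpace R] {a : R} (ha : ‖a‖ < 1) :
    ∃ y, ‖y‖ < 1 ∧ (∀ x, Commute a x → Commute x y) ∧ (1 / 2 : ℝ) • (a + y * y) = y := by
  set f : R → R := fun y => (1 / 2 : ℝ) • (a + y * y) with hf
  set r : ℝ := (1 + ‖a‖) / 2 with hr
  have hr₀ : 0 ≤ r := by positivity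
  have hr₁ : r < 1 := by linarith
  have hnorm_half : ‖(1 / 2 : ℝ)‖ = 1 / 2 := by norm_num
  let 𝓒 : Subalgebra ℝ R := Subalgebra.centralizer ℝ (Set.centralizer {a})
  let K : Set R := Metric.closedBall 0 r ∩ 𝓒
  have ha𝓒 : a ∈ 𝓒 := Set.subset_centralizer_centralizer rfl
  have hK : IsComplete K :=
    (Metric.isClosed_closedBall.inter (Set.isClosed_centralizer _)).isComplete
  have hmaps : Set.MapsTo f K K := by
    rintro y ⟨hy, hy𝓒⟩
    rw [mem_closedBall_zero_iff] at hy
    refine ⟨mem_closedBall_zero_iff.2 ?_, 𝓒.smul_mem (𝓒.add_mem ha𝓒 (𝓒.mul_mem hy𝓒 hy𝓒)) _⟩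
    calc ‖f y‖ = 1 / 2 * ‖a + y * y‖ := by rw [hf, norm_smul, hnorm_half]
      _ ≤ 1 / 2 * (‖a‖ + r * r) := by
        gcongr
        exact norm_add_le_of_le le_rfl (norm_mul_le_of_le hy hy)
      _ ≤ r := by nlinarith
  have hcontr : ContractingWith ⟨r, hr₀⟩ (hmaps.restrict f K K) := by
    refine ⟨hr₁, LipschitzWith.of_dist_le_mul ?_⟩
    rintro ⟨y, hy, -⟩ ⟨z, hz, -⟩
    rw [mem_closedBall_zero_iff] at hy hz
    change dist (f y) (f z) ≤ r * dist y z
    calc dist (f y) (f z) = 1 / 2 * ‖y * y - z * z‖ := by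
          rw [dist_eq_norm, hf, ← smul_sub, add_sub_add_left_eq_sub, norm_smul, hnorm_half]
      _ ≤ 1 / 2 * (2 * r * ‖y - z‖) := by
        gcongr
        exact norm_mul_self_sub_mul_self_le hy hz
      _ = r * dist y z := by rw [dist_eq_norm]; ring
  obtain ⟨y, ⟨hy, hy𝓒⟩, hfix, -⟩ := hcontr.exists_fixedPoint' hK hmaps (x := 0)
    ⟨Metric.mem_closedBall_self hr₀, 𝓒.zero_mem⟩ (edist_ne_top _ _)
  refine ⟨y, (mem_closedBall_zero_iff.1 hy).trans_lt hr₁, fun x hx => ?_, hfix⟩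
  exact hy𝓒 x (fun b hb => by rw [Set.mem_singleton_iff.1 hb, hx.eq])

theorem exists_norm_lt_one_sq_one_sub_eq {R : Type*} [NormedRing R] [NormedAlgebra ℝ R]
    [CompleteSpace R] {a : R} (ha : ‖a‖ < 1) :
    ∃ y, ‖y‖ < 1 ∧ (∀ x, Commute a x → Commute x y) ∧ (1 - y) ^ 2 = 1 - a := by
  obtain ⟨y, hy, hcomm, hfix⟩ := exists_norm_lt_one_half_smul_add_mul_self_eq ha
  refine ⟨y, hy, hcomm, ?_⟩
  have hy₂ : a + y * y = (2 : ℝ) • y := by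
    calc a + y * y = (2 : ℝ) • (1 / 2 : ℝ) • (a + y * y) := by module
      _ = (2 : ℝ) • y := by rw [hfix]
  calc (1 - y) ^ 2 = 1 - (2 : ℝ) • y + y * y := by rw [two_smul]; noncomm_ring
    _ = 1 - a := by rw [← hy₂]; abel

theorem eq_of_sq_eq_sq_of_isUnit_add {R : Type*} [Ring R] {a b : R} (hab : Commute a b)
    (h : a ^ 2 = b ^ 2) (hu : IsUnit (a + b)) : a = b := by
  rw [← sub_eq_zero, ← hu.mul_right_eq_zero, ← hab.sq_sub_sq, h, sub_self]

theorem norm_resolvent_le {𝕜 A : Type*} [NormedField 𝕜] [NormedRing A] [NormedAlgebra 𝕜 A]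
    [CompleteSpace A] [NormOneClass A] {a : A} {z : 𝕜} (h : ‖a‖ < ‖z‖) :
    ‖resolvent a z‖ ≤ (‖z‖ - ‖a‖)⁻¹ := by
  have hinv : resolvent a z * (algebraMap 𝕜 A z - a) = 1 :=
    Ring.inverse_mul_cancel _ (spectrum.mem_resolventSet_of_norm_lt h)
  set v := resolvent a z
  have hle : ‖z‖ * ‖v‖ ≤ 1 + ‖v‖ * ‖a‖ :=
    calc ‖z‖ * ‖v‖ = ‖v * (algebraMap 𝕜 A z - a) + v * a‖ := by
          rw [← mul_add, sub_add_cancel, ← Algebra.commutes, ← Algebra.smul_def, norm_smul]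
      _ ≤ 1 + ‖v‖ * ‖a‖ := norm_add_le_of_le (by rw [hinv, norm_one]) (norm_mul_le _ _)
  rw [← one_div, le_div_iff₀ (sub_pos.2 h)]
  linarith

section NormOneClass

variable {𝔸 : Type*} [NormedRing 𝔸] [NormedAlgebra ℂ 𝔸] [CompleteSpace 𝔸] [NormOneClass 𝔸]

theorem spectralRadius_lt_one_of_norm_lt_one {a : 𝔸} (ha : ‖a‖ < 1) : spectralRadius ℂ a < 1 :=
  (spectrum.spectralRadius_le_nnnorm a).trans_lt (ENNReal.coe_lt_one_iff.2 ha)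

theorem norm_lt_one_of_sq_one_sub_eq {A₁ B C : 𝔸} {β : ℝ} (hA₁ : ‖A₁‖ < 1) (hβ : 0 ≤ β)
    (hC : spectralRadius ℂ C ≤ ENNReal.ofReal β) (hBC : 1 - B = (β : ℂ) • (1 : 𝔸) - C)
    (hsq : (1 - B) ^ 2 = 1 - A₁) : ‖B‖ < 1 := by
  obtain ⟨y, hy, hcomm, hysq⟩ := exists_norm_lt_one_sq_one_sub_eq hA₁
  have hBy : Commute (1 - B) y := hcomm _ <| by
    rw [← sub_sub_cancel 1 A₁, ← hsq]
    exact (Commute.one_left _).sub_left ((Commute.refl _).pow_left 2)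
  have hCy : Commute C y := by
    rw [← sub_sub_cancel ((β : ℂ) • (1 : 𝔸)) C, ← hBC]
    exact ((Commute.one_left y).smul_left _).sub_left hBy
  have hρ : spectralRadius ℂ (C + y) < ‖((β + 1 : ℝ) : ℂ)‖₊ :=
    calc spectralRadius ℂ (C + y) ≤ spectralRadius ℂ C + spectralRadius ℂ y :=
          spectralRadius_add_le_of_commute hCy
      _ < ENNReal.ofReal β + 1 :=
          ENNReal.add_lt_add_of_le_of_lt (spectralRadius_ne_top C) hC
            (spectralRadius_lt_one_of_norm_lt_one hy)
      _ = ‖((β + 1 : ℝ) : ℂ)‖₊ := by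
          rw [Complex.nnnorm_real, ← enorm_eq_nnnorm, Real.enorm_of_nonneg (by positivity),
            ENNReal.ofReal_add hβ zero_le_one, ENNReal.ofReal_one]
  have hunit : IsUnit ((1 - B) + (1 - y)) := by
    have h := spectrum.mem_resolventSet_iff.1 (spectrum.mem_resolventSet_of_spectralRadius_lt hρ)
    rw [Algebra.algebraMap_eq_smul_one] at h
    convert h using 1
    rw [hBC]
    push_cast
    module
  have hcomm' : Commute (1 - B) (1 - y) := (Commute.one_right _).sub_right hBy
  have hBy_eq : 1 - B = 1 - y := eq_of_sq_eq_sq_of_isUnit_add hcomm' (hsq.trans hysq.symm) hunit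
  rwa [sub_right_inj.1 hBy_eq]

theorem isUnit_two_sub_of_norm_lt_one {a : 𝔸} (ha : ‖a‖ < 1) : IsUnit (2 - a) := by
  have h : IsUnit (algebraMap ℂ 𝔸 2 - a) := spectrum.mem_resolventSet_iff.1
    (spectrum.mem_resolventSet_of_norm_lt (by rw [Complex.norm_ofNat]; linarith))
  rwa [map_ofNat] at h

theorem norm_inverse_two_sub_lt_one {a : 𝔸} (ha : ‖a‖ < 1) : ‖Ring.inverse (2 - a)‖ < 1 := by
  have h := norm_resolvent_le (a := a) (z := (2 : ℂ)) (by rw [Complex.norm_ofNat]; linarith)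
  rw [resolvent, map_ofNat, Complex.norm_ofNat] at h
  exact h.trans_lt (inv_lt_one_of_one_lt₀ (by linarith))

end NormOneClass

/-! ### Toeplitz operators -/

theorem norm_matrixOp_apply_le {e : ℕ → ℕ → ℂ} (he : BoundedRows e) (x : LInf) (i : ℕ) :
    ‖matrixOp e he x i‖ ≤ (∑' j, ‖e i j‖) * ‖x‖ := by
  obtain ⟨C, hC⟩ := he
  exact (BoundedRows.row_bound (m := fun _ => e i) (fun _ => ⟨(hC i).1, le_rfl⟩) x i).2

namespace LInf

theorem norm_extend_add_le (n : ℕ) (x : LInf) (i : ℕ) :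
    ‖Function.extend (n + ·) x 0 i‖ ≤ ‖x‖ := by
  by_cases hi : ∃ j, n + j = i
  · obtain ⟨j, rfl⟩ := hi
    rw [(add_right_injective n).extend_apply x 0 j]
    exact lp.norm_apply_le_norm ENNReal.top_ne_zero x j
  · rw [Function.extend_apply' _ _ _ hi, Pi.zero_apply, norm_zero]
    exact norm_nonneg x

/-- The sequence `x` moved by `n` places, preceded by `n` zeros. The rows of a Toeplitz matrix
are translates of each other, so `T(a)` sees `x` in row `i` as it sees the shift in row `n + i`. -/
noncomputable def shift (n : ℕ) (x : LInf) : LInf :=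
  ⟨Function.extend (n + ·) x 0,
    memℓp_infty ⟨‖x‖, Set.forall_mem_range.2 (norm_extend_add_le n x)⟩⟩

theorem shift_apply_add (n : ℕ) (x : LInf) (j : ℕ) : shift n x (n + j) = x j :=
  (add_right_injective n).extend_apply x 0 j

theorem shift_apply_of_lt {n j : ℕ} (x : LInf) (hj : j < n) : shift n x j = 0 :=
  Function.extend_apply' (f := (n + ·)) x 0 j fun ⟨_, hk⟩ =>
    (Nat.le_add_right n _).not_gt (hk.trans_lt hj)

theorem norm_shift_le (n : ℕ) (x : LInf) : ‖shift n x‖ ≤ ‖x‖ :=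
  lp.norm_le_of_forall_le (norm_nonneg x) (norm_extend_add_le n x)

end LInf

theorem toeplitz_shift_apply_add (b : Wiener) (n : ℕ) (x : LInf) (i : ℕ) :
    toeplitz b (x.shift n) (n + i) = toeplitz b x i := by
  change ∑' j : ℕ, b.1 ((j : ℤ) - ((n + i : ℕ) : ℤ)) * x.shift n j
    = ∑' j : ℕ, b.1 ((j : ℤ) - (i : ℤ)) * x j
  rw [← (add_right_injective n).tsum_eq]
  · refine tsum_congr fun j => ?_
    rw [LInf.shift_apply_add]
    push_cast
    rw [add_sub_add_left_eq_sub]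
  · refine fun j hj => ⟨j - n, Nat.add_sub_cancel' (not_lt.1 fun hjn => hj ?_)⟩
    exact mul_eq_zero_of_right _ (LInf.shift_apply_of_lt x hjn)

theorem norm_toeplitz_le_norm_toeplitz_add (b : Wiener) {E : LInfOp} (hE : E ∈ Kd) :
    ‖toeplitz b‖ ≤ ‖toeplitz b + E‖ := by
  obtain ⟨e, he, hlim, rfl⟩ := hE
  refine ContinuousLinearMap.opNorm_le_bound _ (norm_nonneg _) fun x => ?_
  refine lp.norm_le_of_forall_le (by positivity) fun i => ?_
  have hrow : ∀ n, ‖toeplitz b x i‖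
      ≤ (‖toeplitz b + matrixOp e he‖ + ∑' j, ‖e (n + i) j‖) * ‖x‖ := fun n =>
    calc ‖toeplitz b x i‖
        = ‖(toeplitz b + matrixOp e he) (x.shift n) (n + i)
            - matrixOp e he (x.shift n) (n + i)‖ := by
          rw [← toeplitz_shift_apply_add b n, add_apply]
          exact congrArg norm (add_sub_cancel_right _ _).symm
      _ ≤ ‖toeplitz b + matrixOp e he‖ * ‖x.shift n‖
          + (∑' j, ‖e (n + i) j‖) * ‖x.shift n‖ :=
        norm_sub_le_of_le ((lp.norm_apply_le_norm ENNReal.top_ne_zero _ _).trans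
          (ContinuousLinearMap.le_opNorm _ _)) (norm_matrixOp_apply_le he _ _)
      _ ≤ (‖toeplitz b + matrixOp e he‖ + ∑' j, ‖e (n + i) j‖) * ‖x‖ := by
        rw [← add_mul]
        gcongr
        exact LInf.norm_shift_le n x
  have hlim' : Tendsto (fun n => (‖toeplitz b + matrixOp e he‖ + ∑' j, ‖e (n + i) j‖) * ‖x‖)
      atTop (𝓝 ((‖toeplitz b + matrixOp e he‖ + 0) * ‖x‖)) :=
    ((hlim.comp (tendsto_add_atTop_nat i)).const_add _).mul_const _
  rw [add_zero] at hlim'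
  exact ge_of_tendsto' hlim' hrow

instance : Nontrivial LInf := NormOneClass.nontrivial

instance : NormOneClass LInfOp := ⟨ContinuousLinearMap.norm_id⟩

/-! ### Quadratic convergence -/

theorem mainTheorem3_general {𝔸 : Type*} [NormedRing 𝔸] [NormedAlgebra ℂ 𝔸] [CompleteSpace 𝔸]
    [NormOneClass 𝔸] {A₁ B C T X S R V Z : 𝔸} {β : ℝ} {pencil : SSF 𝔸}
    (hA₁ : ‖A₁‖ < 1) (hT : ‖T‖ < 1) (hB : B = T + X) (hβ : 0 ≤ β)
    (hC : spectralRadius ℂ C ≤ ENNReal.ofReal β) (hBC : 1 - B = (β : ℂ) • (1 : 𝔸) - C)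
    (hsq : (1 - B) ^ 2 = 1 - A₁)
    (hS : S = Ring.inverse (2 - T))
    (hR : R = T ^ 2 - 2 * T + A₁)
    (hV : V = Ring.inverse (2 - B))
    (hZ : Z = (1 - T * V) * V * Ring.inverse (1 - T * V))
    (hpM : pencil.M = !![S * A₁, 0; -(S * R), 1])
    (hpN : pencil.N = !![1, -S; 0, S]) :
    IsUnit (2 - T) ∧ IsUnit (2 - B) ∧ IsUnit (1 - T * V) ∧
    (pencil.NoBreakdown →
      Tendsto (fun k => (pencil.sda k).P) atTop (𝓝 X) ∧
      limsup (fun k : ℕ => ‖X - (pencil.sda k).P‖ₑ ^ ((1 : ℝ) / 2 ^ k)) atTop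
        ≤ spectralRadius ℂ B * spectralRadius ℂ Z ∧
      spectralRadius ℂ B * spectralRadius ℂ Z < 1) := by
  have hB₁ : ‖B‖ < 1 := norm_lt_one_of_sq_one_sub_eq hA₁ hβ hC hBC hsq
  have hV₁ : ‖V‖ < 1 := hV ▸ norm_inverse_two_sub_lt_one hB₁
  have huT : IsUnit (2 - T) := isUnit_two_sub_of_norm_lt_one hT
  have huB : IsUnit (2 - B) := isUnit_two_sub_of_norm_lt_one hB₁
  have huTV : IsUnit (1 - T * V) := isUnit_one_sub_of_norm_lt_one <|
    (norm_mul_le T V).trans_lt (mul_lt_one_of_nonneg_of_lt_one_left (norm_nonneg T) hT hV₁.le)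
  refine ⟨huT, huB, huTV, fun hs => ?_⟩
  have hρ : spectralRadius ℂ B * spectralRadius ℂ Z < 1 := by
    rw [hZ, spectralRadius_mul_mul_ringInverse huTV]
    exact mul_lt_one' (spectralRadius_lt_one_of_norm_lt_one hB₁)
      (spectralRadius_lt_one_of_norm_lt_one hV₁)
  have hS₁ : S * (2 - T) = 1 := hS ▸ Ring.inverse_mul_cancel _ huT
  have hV₂ : (2 - B) * V = 1 := hV ▸ Ring.mul_inverse_cancel _ huB
  have hXB : pencil.IsDeflatingPair X B := by
    rw [SSF.eq_sqrtPencil (hR ▸ hpM) hpN]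
    exact sqrtPencil_isDeflatingPair hB hsq hS₁
  have hYZ : pencil.swap.IsDeflatingPair (V * Ring.inverse (1 - T * V)) Z := by
    rw [SSF.eq_sqrtPencil (hR ▸ hpM) hpN, hZ]
    exact sqrtPencil_swap_isDeflatingPair hsq hS₁ hV₂ (Ring.mul_inverse_cancel _ huTV)
      (Ring.inverse_mul_cancel _ huTV)
  obtain ⟨hlim, hrate⟩ := hXB.sda_P_tendsto_and_limsup_le hYZ hs hρ
  exact ⟨hlim, hrate, hρ⟩

theorem mainTheorem3 (A A₁ B E_B : LInfOp) (b : Wiener)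
    (hA : A ∈ QT) (hAA₁ : A = 1 - A₁) (hA₁ : EntrywiseNonneg A₁) (hA₁_norm : ‖A₁‖ < 1)
    (hE_B : E_B ∈ Kd) (hB : B = toeplitz b + E_B)
    (hM : IsQTMMatrix (1 - B)) (hsq : (1 - B) ^ 2 = A)
    (S R V Z : LInfOp)
    (hS : S = Ring.inverse (2 - toeplitz b))
    (hR : R = toeplitz b ^ 2 - 2 * toeplitz b + A₁)
    (hV : V = Ring.inverse (2 - B))
    (hZ : Z = (1 - toeplitz b * V) * V * Ring.inverse (1 - toeplitz b * V))
    (pencil : SSF LInfOp)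
    (hpM : pencil.M = !![S * A₁, 0; -(S * R), 1])
    (hpN : pencil.N = !![1, -S; 0, S]) :
    IsUnit (2 - toeplitz b) ∧ IsUnit (2 - B) ∧ IsUnit (1 - toeplitz b * V) ∧
    (pencil.NoBreakdown →
      Tendsto (fun k => (pencil.sda k).P) atTop (𝓝 E_B) ∧
      limsup (fun k : ℕ => ‖E_B - (pencil.sda k).P‖ₑ ^ ((1 : ℝ) / 2 ^ k)) atTop
        ≤ spectralRadius ℂ B * spectralRadius ℂ Z ∧
      spectralRadius ℂ B * spectralRadius ℂ Z < 1) := by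
  obtain ⟨-, β, C, hβ, -, hC, hBC⟩ := hM
  exact mainTheorem3_general hA₁_norm ((hB ▸ norm_toeplitz_le_norm_toeplitz_add b hE_B).trans_lt
    (norm_lt_one_of_sq_one_sub_eq hA₁_norm hβ hC hBC (hsq.trans hAA₁))) hB hβ hC hBC
    (hsq.trans hAA₁) hS hR hV hZ hpM hpN
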